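/- There are universal constants $C_1,C_2>0$ such that the following holds. Let $d\ge 0$, $m\ge 1$ be integers, $\delta\in(0,1)$ with $m/\delta\ge 2$ (no restriction if $m\ge 2$; if $m=1$ it says $\delta\le 1/2$), $W\ge 0$, and let $u:\mathbb{R}\to[0,1]$ be a (known) non-decreasing $1$-Lipschitz function. Let $D$ be a probability distribution of $(x,y)$ supported on $\mathbb{B}_d\times[0,1]$, where $\mathbb{B}_d=\{x\in\mathbb{R}^d:\|x\|\le 1\}$ is the Euclidean unit ball, such that $\mathbb{E}[y\mid x]=u(w\cdot x)$ almost surely for some $w\in\mathbb{R}^d$ with $\|w\|\le W$. Draw $(x_1,y_1),\dots,(x_m,y_m)$ independently from $D$ and define the GLM-tron iterates by $w^1=0$ and $$w^{t+1}=w^t+\frac1m\sum_{i=1}^m\bigl(y_i-u(w^t\cdot x_i)\bigr)x_i,\qquad h^t(x)=u(w^t\cdot x)\qquad(t=1,2,\dots).$$ For $h:\mathbb{R}^d\to[0,1]$ measurable let $\mathrm{err}(h)=\mathbb{E}_{(x,y)\sim D}[(h(x)-y)^2]$, let $\varepsilon(h)=\mathrm{err}(h)-\mathrm{err}(\mathbb{E}[y\mid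 x])$ be the excess error, and let $\hat\varepsilon(h)=\frac1m\sum_{i=1}^m(h(x_i)-u(w\cdot x_i))^2$ be the fixed design error. Then with probability at least $1-\delta$ over the sample there is an iteration $t\ge 1$ such that $$t=1\quad\text{or}\quad t<C_1\,W\sqrt{\frac{m}{\log(1/\delta)}},\qquad\text{and}\qquad \max\{\hat\varepsilon(h^t),\varepsilon(h^t)\}\le C_2\sqrt{\frac{W^2\log(m/\delta)}{m}}.$$ -/

import Mathlib

open MeasureTheory ProbabilityTheory

namespace GLMTron

/-- Labelled points `(x, y)` with `x ∈ ℝ^d` (Euclidean norm) and a real label `y`. -/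
abbrev Point (d : ℕ) : Type := EuclideanSpace ℝ (Fin d) × ℝ

/-- One update `v ↦ v + (1/m) ∑ i, (y_i - u (v ⬝ x_i)) x_i` on the sample `S`. -/
noncomputable def step {d m : ℕ} (u : ℝ → ℝ) (S : Fin m → Point d)
    (v : EuclideanSpace ℝ (Fin d)) : EuclideanSpace ℝ (Fin d) :=
  v + (1 / (m : ℝ)) • ∑ i, ((S i).2 - u (inner ℝ v (S i).1)) • (S i).1

/-- The GLM-tron weight vectors `w^t`, `t = 1, 2, …`, with `w^1 = 0`.
The index `t = 0` is not used. -/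
noncomputable def weight {d m : ℕ} (u : ℝ → ℝ) (S : Fin m → Point d) (t : ℕ) :
    EuclideanSpace ℝ (Fin d) :=
  (step u S)^[t - 1] 0

theorem weight_one {d m : ℕ} (u : ℝ → ℝ) (S : Fin m → Point d) : weight u S 1 = 0 := rfl

theorem weight_succ {d m : ℕ} (u : ℝ → ℝ) (S : Fin m → Point d) {t : ℕ} (ht : 1 ≤ t) :
    weight u S (t + 1) = weight u S t + (1 / (m : ℝ)) •
      ∑ i, ((S i).2 - u (inner ℝ (weight u S t) (S i).1)) • (S i).1 := by
  obtain ⟨k, rfl⟩ : ∃ k, t = k + 1 := ⟨t - 1, by omega⟩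
  simp only [weight, Nat.add_sub_cancel, Function.iterate_succ_apply']
  rfl

/-- The GLM-tron hypothesis `h^t(x) = u (w^t ⬝ x)`. -/
noncomputable def hyp {d m : ℕ} (u : ℝ → ℝ) (S : Fin m → Point d) (t : ℕ)
    (x : EuclideanSpace ℝ (Fin d)) : ℝ :=
  u (inner ℝ (weight u S t) x)

/-- The conditional expectation `E[y | x]` under the distribution `D` of `(x, y)`. -/
noncomputable def regression {d : ℕ} (D : Measure (Point d)) : Point d → ℝ :=
  D[fun p : Point d => p.2 | MeasurableSpace.comap Prod.fst inferInstance]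

/-- The squared error `err(h) = E[(h(x) - y)^2]`. -/
noncomputable def err {d : ℕ} (D : Measure (Point d)) (h : EuclideanSpace ℝ (Fin d) → ℝ) : ℝ :=
  ∫ p, (h p.1 - p.2) ^ 2 ∂D

/-- The excess error `ε(h) = err(h) - err(E[y | x])`. -/
noncomputable def excessErr {d : ℕ} (D : Measure (Point d))
    (h : EuclideanSpace ℝ (Fin d) → ℝ) : ℝ :=
  err D h - ∫ p, (regression D p - p.2) ^ 2 ∂D

/-- The fixed design error `(1/m) ∑ i, (h(x_i) - u (w ⬝ x_i))^2`. -/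
noncomputable def empExcessErr {d m : ℕ} (u : ℝ → ℝ) (w : EuclideanSpace ℝ (Fin d))
    (S : Fin m → Point d) (h : EuclideanSpace ℝ (Fin d) → ℝ) : ℝ :=
  (1 / (m : ℝ)) * ∑ i, (h (S i).1 - u (inner ℝ w (S i).1)) ^ 2

end GLMTron

/-! The proof separates a deterministic descent argument from dimension-free concentration.

Descent. The update at `v` is a signal term, which would arise from the noiseless labels u(w·x_i),
plus the vector `noise u w S`, which does not depend on `v`. Since `u` is monotone and 1-Lipschitz,
the signal has inner product with w - v at least the fixed design error, which also bounds its
squared norm. Thus, if the noise has norm at most η ≤ W, a step from inside the ball of radius W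
about `w` lowers the squared distance to `w` by half the fixed design error, up to 5Wη
(`norm_sq_step_sub_le`). The squared distance starts at most W², so an error at most 12Wη occurs
within about W/η steps, while the iterate is still in that ball (`exists_weight_empExcessErr_le`).

Concentration. Both the noise norm and the gap between excess and fixed design error, uniformly over
the ball, are suprema of mean minus sample average for functions whose increments are dominated by
linear functionals of x. Uniformity allows the iterate to depend on the sample. The exponential
moment of such a supremum is bounded one coordinate at a time: symmetrization and contraction
replace the function by the linear functional, and a smooth substitute for the Hilbert norm absorbs
it (`integral_maxExp_pi_le`). Markov's inequality gives tail exp(1 - mη²/16), and η is of order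
√(log(m/δ)/m). -/

namespace GLMTron

/-- Weak majorization for the increasing convex function exp. In the main case t < q ≤ p ≤ s, the
tangent lines at p and q suffice: the slope at p is the larger, and the gain s - p is at least the
loss q - t. -/
theorem exp_add_exp_le_of_majorized {p q s t : ℝ} (hsum : p + q ≤ s + t)
    (hp : p ≤ max s t) (hq : q ≤ max s t) :
    Real.exp p + Real.exp q ≤ Real.exp s + Real.exp t := by
  wlog hst : t ≤ s generalizing s t
  · rw [add_comm (Real.exp s)]
    exact this (by linarith) (by rwa [max_comm]) (by rwa [max_comm]) (le_of_not_ge hst)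
  wlog hpq : q ≤ p generalizing p q
  · rw [add_comm (Real.exp p)]
    exact this (by linarith) hq hp (le_of_not_ge hpq)
  rw [max_eq_left hst] at hp hq
  rcases le_or_gt q t with h | h
  · exact add_le_add (Real.exp_le_exp.2 hp) (Real.exp_le_exp.2 h)
  have h1 : Real.exp p * (s - p + 1) ≤ Real.exp s := by
    calc _ ≤ Real.exp p * Real.exp (s - p) := by gcongr; exact Real.add_one_le_exp _
      _ = _ := by rw [← Real.exp_add]; ring_nf
  have h2 : Real.exp q * (t - q + 1) ≤ Real.exp t := by
    calc _ ≤ Real.exp q * Real.exp (t - q) := by gcongr; exact Real.add_one_le_exp _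
      _ = _ := by rw [← Real.exp_add]; ring_nf
  have h3 : Real.exp q * (q - t) ≤ Real.exp p * (s - p) := by
    exact mul_le_mul (Real.exp_le_exp.2 hpq) (by linarith) (by linarith) (Real.exp_pos _).le
  linarith

/-- The exponential of the maximum of a finite family of reals. -/
noncomputable def maxExp {ι : Type*} (a : ι → ℝ) : ℝ := ⨆ i, Real.exp (a i)

/-! ### Symmetrization and contraction for exponentials of finite maxima. -/

section maxExp

theorem maxExp_le_exp {ι : Type*} [Nonempty ι] {a : ι → ℝ} {C : ℝ} (h : ∀ i, a i ≤ C) :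
    maxExp a ≤ Real.exp C :=
  ciSup_le fun i => Real.exp_le_exp.2 (h i)

theorem maxExp_nonneg {ι : Type*} (a : ι → ℝ) : 0 ≤ maxExp a :=
  Real.iSup_nonneg fun _ => (Real.exp_pos _).le

variable {ι : Type*} [Finite ι]

theorem exp_le_maxExp (a : ι → ℝ) (i : ι) : Real.exp (a i) ≤ maxExp a :=
  le_ciSup (f := fun i => Real.exp (a i)) (Set.finite_range _).bddAbove i

theorem exists_maxExp_eq [Nonempty ι] (a : ι → ℝ) : ∃ i, maxExp a = Real.exp (a i) := by
  obtain ⟨i, hi⟩ := exists_eq_ciSup_of_finite (f := fun i => Real.exp (a i))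
  exact ⟨i, hi.symm⟩

theorem measurable_maxExp {α : Type*} [MeasurableSpace α] {a : α → ι → ℝ}
    (ha : ∀ i, Measurable fun x => a x i) : Measurable fun x => maxExp (a x) :=
  Measurable.iSup fun i => Real.measurable_exp.comp (ha i)

theorem integrable_maxExp [Nonempty ι] {α : Type*} [MeasurableSpace α] (μ : Measure α)
    [IsFiniteMeasure μ] {a : α → ι → ℝ} (ha : ∀ i, Measurable fun x => a x i) (C : ℝ)
    (hC : ∀ x i, a x i ≤ C) : Integrable (fun x => maxExp (a x)) μ := by
  refine Integrable.of_bound (measurable_maxExp ha).aestronglyMeasurable (Real.exp C) ?_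
  filter_upwards with x
  rw [Real.norm_of_nonneg (maxExp_nonneg _)]
  exact maxExp_le_exp (hC x)

/-- One coordinate of the Ledoux–Talagrand contraction principle. -/
theorem maxExp_contraction [Nonempty ι] (A b c : ι → ℝ) (h0 : ∀ i, |c i| ≤ |b i|)
    (h1 : ∀ i j, |c i - c j| ≤ |b i - b j|) :
    maxExp (fun i => A i + c i) + maxExp (fun i => A i - c i) ≤
      maxExp (fun i => A i + b i) + maxExp (fun i => A i - b i) := by
  obtain ⟨i, hi⟩ := exists_maxExp_eq fun i => A i + c i
  obtain ⟨j, hj⟩ := exists_maxExp_eq fun i => A i - c i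
  obtain ⟨k, hk⟩ := exists_maxExp_eq fun i => A i + b i
  obtain ⟨l, hl⟩ := exists_maxExp_eq fun i => A i - b i
  have hk' : ∀ r, A r + b r ≤ A k + b k := fun r => by
    have := exp_le_maxExp (fun i => A i + b i) r
    rwa [hk, Real.exp_le_exp] at this
  have hl' : ∀ r, A r - b r ≤ A l - b l := fun r => by
    have := exp_le_maxExp (fun i => A i - b i) r
    rwa [hl, Real.exp_le_exp] at this
  -- Domination of `c` by `b` controls each exponent separately; domination of the increments, used
  -- below, controls the sum of the two. Together these are the majorization hypotheses.
  have hmax : ∀ r, A r + |c r| ≤ max (A k + b k) (A l - b l) := fun r => by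
    rcases abs_cases (b r) with h | h
    · exact le_max_of_le_left (by linarith [hk' r, h0 r])
    · exact le_max_of_le_right (by linarith [hl' r, h0 r])
  rw [hi, hj, hk, hl]
  apply exp_add_exp_le_of_majorized
  · have := h1 i j
    have := le_abs_self (c i - c j)
    rcases abs_cases (b i - b j) with h | h
    · linarith [hk' i, hl' j]
    · linarith [hk' j, hl' i]
  · linarith [hmax i, le_abs_self (c i)]
  · linarith [hmax j, neg_abs_le (c j)]

/-- At a maximizing index the exponent is the midpoint of A + 2b and A - 2c, so convexity of exp
applies. This separates the mean from the sample value at the cost of a factor 2 in the exponent. -/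
theorem maxExp_add_le [Nonempty ι] (A b c : ι → ℝ) :
    maxExp (fun i => A i + b i - c i) ≤
      1 / 2 * (maxExp (fun i => A i + 2 * b i) + maxExp (fun i => A i - 2 * c i)) := by
  obtain ⟨i, hi⟩ := exists_maxExp_eq fun i => A i + b i - c i
  have h := exp_add_exp_le_of_majorized (p := A i + b i - c i) (q := A i + b i - c i)
    (s := A i + 2 * b i) (t := A i - 2 * c i) (by linarith)
    (by rcases le_total (b i) (-c i) with h | h
        · exact le_max_of_le_right (by linarith)
        · exact le_max_of_le_left (by linarith))
    (by rcases le_total (b i) (-c i) with h | h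
        · exact le_max_of_le_right (by linarith)
        · exact le_max_of_le_left (by linarith))
  have h1 := exp_le_maxExp (fun i => A i + 2 * b i) i
  have h2 := exp_le_maxExp (fun i => A i - 2 * c i) i
  rw [hi]
  linarith

theorem maxExp_integral_le [Nonempty ι] {Ω : Type*} [MeasurableSpace Ω] (P : Measure Ω)
    [IsProbabilityMeasure P] (A : ι → ℝ) {f : ι → Ω → ℝ} (hf : ∀ i, Measurable (f i)) (C : ℝ)
    (hC : ∀ i ω, |f i ω| ≤ C) :
    maxExp (fun i => A i + 2 * ∫ ω, f i ω ∂P) ≤ ∫ ω, maxExp (fun i => A i + 2 * f i ω) ∂P := by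
  obtain ⟨i, hi⟩ := exists_maxExp_eq fun i => A i + 2 * ∫ ω, f i ω ∂P
  obtain ⟨M, hM⟩ := (Set.finite_range A).bddAbove
  have hM' : ∀ i, A i ≤ M := fun i => hM ⟨i, rfl⟩
  have hint : Integrable (f i) P :=
    Integrable.of_bound (hf i).aestronglyMeasurable C (Filter.Eventually.of_forall (hC i))
  have hint' : Integrable (fun ω => A i + 2 * f i ω) P :=
    (integrable_const _).add (hint.const_mul _)
  have hsup := integrable_maxExp P (a := fun ω i => A i + 2 * f i ω)
    (fun i => by have := hf i; fun_prop) (M + 2 * C)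
    (fun ω i => by linarith [hM' i, (abs_le.1 (hC i ω)).2])
  have hexp : Integrable (fun ω => Real.exp (A i + 2 * f i ω)) P := by
    refine hsup.mono' (by have := hf i; fun_prop) ?_
    filter_upwards with ω
    rw [Real.norm_of_nonneg (Real.exp_pos _).le]
    exact exp_le_maxExp (fun i => A i + 2 * f i ω) i
  have hval : A i + 2 * ∫ ω, f i ω ∂P = ∫ ω, A i + 2 * f i ω ∂P := by
    rw [integral_add (integrable_const _) (hint.const_mul _), integral_const_mul]
    simp
  rw [hi, hval]
  refine le_trans (convexOn_exp.map_integral_le Real.continuous_exp.continuousOn isClosed_univ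
    (Filter.Eventually.of_forall fun _ => Set.mem_univ _) hint' hexp) ?_
  exact integral_mono hexp hsup fun ω => exp_le_maxExp (fun i => A i + 2 * f i ω) i

end maxExp

theorem abs_integral_le_of_abs_le {Ω : Type*} [MeasurableSpace Ω] (P : Measure Ω)
    [IsProbabilityMeasure P] {f : Ω → ℝ} {C : ℝ}
    (h : ∀ ω, |f ω| ≤ C) : |∫ ω, f ω ∂P| ≤ C := by
  have := norm_integral_le_of_norm_le_const (μ := P)
    (Filter.Eventually.of_forall fun ω => (Real.norm_eq_abs _).trans_le (h ω))
  simpa using this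

/-- Symmetrization and contraction in one coordinate. -/
theorem integral_maxExp_symmetrize_le {ι Ω : Type*} [Finite ι] [Nonempty ι] [MeasurableSpace Ω]
    (P : Measure Ω) [IsProbabilityMeasure P] (A : ι → ℝ) {f g : ι → Ω → ℝ}
    (hf : ∀ i, Measurable (f i)) (hg : ∀ i, Measurable (g i)) (C : ℝ)
    (hC : ∀ i ω, |g i ω| ≤ C) (h0 : ∀ i ω, |f i ω| ≤ |g i ω|)
    (h1 : ∀ i j ω, |f i ω - f j ω| ≤ |g i ω - g j ω|) :
    ∫ ω, maxExp (fun i => A i + ∫ ω', f i ω' ∂P - f i ω) ∂P ≤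
      ∫ ω, 1 / 2 * (maxExp (fun i => A i + 2 * g i ω) + maxExp (fun i => A i - 2 * g i ω)) ∂P := by
  have hCf : ∀ i ω, |f i ω| ≤ C := fun i ω => (h0 i ω).trans (hC i ω)
  obtain ⟨M, hM⟩ := (Set.finite_range A).bddAbove
  have hM' : ∀ i, A i ≤ M := fun i => hM ⟨i, rfl⟩
  have hE : ∀ i, |∫ ω', f i ω' ∂P| ≤ C := fun i => abs_integral_le_of_abs_le P (hCf i)
  have i0 := integrable_maxExp P (a := fun ω i => A i + ∫ ω', f i ω' ∂P - f i ω)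
    (fun i => by have := hf i; fun_prop) (M + C + C)
    (fun ω i => by linarith [hM' i, (abs_le.1 (hCf i ω)).1, (abs_le.1 (hE i)).2])
  have i1 := integrable_maxExp P (a := fun ω i => A i + 2 * f i ω)
    (fun i => by have := hf i; fun_prop) (M + 2 * C)
    (fun ω i => by linarith [hM' i, (abs_le.1 (hCf i ω)).2])
  have i2 := integrable_maxExp P (a := fun ω i => A i - 2 * f i ω)
    (fun i => by have := hf i; fun_prop) (M + 2 * C)
    (fun ω i => by linarith [hM' i, (abs_le.1 (hCf i ω)).1])
  have i3 := integrable_maxExp P (a := fun ω i => A i + 2 * g i ω)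
    (fun i => by have := hg i; fun_prop) (M + 2 * C)
    (fun ω i => by linarith [hM' i, (abs_le.1 (hC i ω)).2])
  have i4 := integrable_maxExp P (a := fun ω i => A i - 2 * g i ω)
    (fun i => by have := hg i; fun_prop) (M + 2 * C)
    (fun ω i => by linarith [hM' i, (abs_le.1 (hC i ω)).1])
  -- Midpoint convexity, then Jensen to move the mean out of the maximum. Both signs of f now occur
  -- at the same ω, so the contraction applies pointwise without auxiliary random signs.
  calc _ ≤ ∫ ω, 1 / 2 * (maxExp (fun i => A i + 2 * ∫ ω', f i ω' ∂P)
          + maxExp (fun i => A i - 2 * f i ω)) ∂P :=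
        integral_mono i0 (((integrable_const _).add i2).const_mul _)
          fun ω => maxExp_add_le A (fun i => ∫ ω', f i ω' ∂P) (fun i => f i ω)
    _ = 1 / 2 * (maxExp (fun i => A i + 2 * ∫ ω', f i ω' ∂P)
          + ∫ ω, maxExp (fun i => A i - 2 * f i ω) ∂P) := by
        rw [integral_const_mul, integral_add (integrable_const _) i2]
        simp
    _ ≤ 1 / 2 * (∫ ω, maxExp (fun i => A i + 2 * f i ω) ∂P
          + ∫ ω, maxExp (fun i => A i - 2 * f i ω) ∂P) := by
        gcongr
        exact maxExp_integral_le P A hf C hCf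
    _ = ∫ ω, 1 / 2 * (maxExp (fun i => A i + 2 * f i ω)
          + maxExp (fun i => A i - 2 * f i ω)) ∂P := by
        rw [integral_const_mul, integral_add i1 i2]
    _ ≤ _ := by
        refine integral_mono ((i1.add i2).const_mul _) ((i3.add i4).const_mul _) fun ω => ?_
        have := maxExp_contraction A (fun i => 2 * g i ω) (fun i => 2 * f i ω)
          (fun i => by
            simpa only [abs_mul] using mul_le_mul_of_nonneg_left (h0 i ω) (abs_nonneg 2))
          (fun i j => by
            simpa only [← mul_sub, abs_mul] using
              mul_le_mul_of_nonneg_left (h1 i j ω) (abs_nonneg 2))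
        simp only
        gcongr 1 / 2 * ?_

/-- The function √(1 + ‖z‖²) is a smooth upper bound for the norm. Bounding the root linearly leaves
the terms ±⟨z, x⟩/s, which average to a cosh; cosh r ≤ exp(r²/2) and Cauchy–Schwarz finish. The
added 1 ensures s ≥ 1. -/
theorem exp_sqrt_add_exp_sqrt_le {E : Type*} [NormedAddCommGroup E] [InnerProductSpace ℝ E]
    (z x : E) :
    1 / 2 * (Real.exp (√(1 + ‖z + x‖ ^ 2)) + Real.exp (√(1 + ‖z - x‖ ^ 2))) ≤
      Real.exp (√(1 + ‖z‖ ^ 2) + ‖x‖ ^ 2) := by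
  set s := √(1 + ‖z‖ ^ 2) with hs
  have hs2 : s ^ 2 = 1 + ‖z‖ ^ 2 := Real.sq_sqrt (by positivity)
  have hs1 : 1 ≤ s := Real.one_le_sqrt.2 (by nlinarith [sq_nonneg ‖z‖])
  have hs0 : 0 < s := by linarith
  have key : ∀ c : ℝ, 0 ≤ s ^ 2 + ‖x‖ ^ 2 + 2 * c →
      √(s ^ 2 + ‖x‖ ^ 2 + 2 * c) ≤ s + ‖x‖ ^ 2 / 2 + c / s := fun c hc => by
    have h1 : s + (‖x‖ ^ 2 + 2 * c) / (2 * s) ≤ s + ‖x‖ ^ 2 / 2 + c / s := by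
      have : ‖x‖ ^ 2 / (2 * s) ≤ ‖x‖ ^ 2 / 2 := by
        gcongr; linarith
      have h2 : (‖x‖ ^ 2 + 2 * c) / (2 * s) = ‖x‖ ^ 2 / (2 * s) + c / s := by
        field_simp
      linarith
    refine le_trans ?_ h1
    have h3 : s + (‖x‖ ^ 2 + 2 * c) / (2 * s) =
        (s ^ 2 + (s ^ 2 + ‖x‖ ^ 2 + 2 * c)) / (2 * s) := by field_simp; ring
    rw [h3, le_div_iff₀ (by positivity)]
    nlinarith [sq_nonneg (s - √(s ^ 2 + ‖x‖ ^ 2 + 2 * c)), Real.sq_sqrt hc]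
  have e1 : 1 + ‖z + x‖ ^ 2 = s ^ 2 + ‖x‖ ^ 2 + 2 * inner ℝ z x := by
    rw [norm_add_sq_real, hs2]; ring
  have e2 : 1 + ‖z - x‖ ^ 2 = s ^ 2 + ‖x‖ ^ 2 + 2 * (-inner ℝ z x) := by
    rw [norm_sub_sq_real, hs2]; ring
  have k1 := key (inner ℝ z x) (by rw [← e1]; positivity)
  have k2 := key (-inner ℝ z x) (by rw [← e2]; positivity)
  rw [e1, e2]
  set r : ℝ := inner ℝ z x / s with hr
  have hcosh := Real.cosh_le_exp_half_sq r
  have hr2 : r ^ 2 ≤ ‖x‖ ^ 2 := by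
    rw [hr, div_pow, div_le_iff₀ (by positivity), hs2]
    have := abs_real_inner_le_norm z x
    have h4 : (inner ℝ z x : ℝ) ^ 2 ≤ (‖z‖ * ‖x‖) ^ 2 := sq_le_sq' (by
      linarith [neg_abs_le (inner ℝ z x : ℝ)]) (by linarith [le_abs_self (inner ℝ z x : ℝ)])
    nlinarith [sq_nonneg ‖x‖]
  calc _ ≤ 1 / 2 * (Real.exp (s + ‖x‖ ^ 2 / 2 + r) + Real.exp (s + ‖x‖ ^ 2 / 2 + -r)) := by
        gcongr
        simpa [neg_div] using k2
    _ = Real.exp (s + ‖x‖ ^ 2 / 2) * Real.cosh r := by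
        rw [Real.cosh_eq, Real.exp_add _ r, Real.exp_add _ (-r)]; ring
    _ ≤ Real.exp (s + ‖x‖ ^ 2 / 2) * Real.exp (r ^ 2 / 2) := by gcongr
    _ ≤ _ := by
        rw [← Real.exp_add, Real.exp_le_exp]; linarith

/-! ### Dimension-free uniform deviation bounds. -/

section Concentration

variable {Ω E : Type*} [MeasurableSpace Ω] [NormedAddCommGroup E] [InnerProductSpace ℝ E]

theorem abs_inner_le_of_norm_le {b x : E} {B : ℝ} (hb : ‖b‖ ≤ B) (hx : ‖x‖ ≤ 1) :
    |inner ℝ b x| ≤ B :=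
  calc |inner ℝ b x| ≤ ‖b‖ * ‖x‖ := abs_real_inner_le_norm b x
    _ ≤ B * 1 := mul_le_mul hb hx (norm_nonneg _) ((norm_nonneg _).trans hb)
    _ = B := mul_one B

theorem exp_sqrt_potential_le {B : ℝ} (z x : E) (hx : ‖x‖ ≤ 1) :
    1 / 2 * (Real.exp (√(1 + ‖B • (z + (2 : ℝ) • x)‖ ^ 2))
        + Real.exp (√(1 + ‖B • (z - (2 : ℝ) • x)‖ ^ 2))) ≤
      Real.exp (√(1 + ‖B • z‖ ^ 2) + 4 * B ^ 2) := by
  rw [smul_add, smul_sub]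
  refine (exp_sqrt_add_exp_sqrt_le _ _).trans (Real.exp_le_exp.2 ?_)
  have h : ‖B • (2 : ℝ) • x‖ ^ 2 = 4 * B ^ 2 * ‖x‖ ^ 2 := by
    rw [norm_smul, norm_smul, mul_pow, mul_pow, Real.norm_eq_abs, sq_abs]; norm_num; ring
  have : ‖x‖ ^ 2 ≤ 1 := pow_le_one₀ (norm_nonneg _) hx
  rw [h]
  nlinarith [sq_nonneg B]

/-- Exponential moment of the largest deviation in a family of functions dominated, together
with its increments, by bounded linear functionals of `X`. -/
theorem integral_maxExp_pi_le {ι : Type*} [Finite ι] [Nonempty ι] (P : Measure Ω)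
    [IsProbabilityMeasure P] {X : Ω → E} (hX : ∀ ω, ‖X ω‖ ≤ 1) {b : ι → E} {B : ℝ}
    (hb : ∀ i, ‖b i‖ ≤ B) (hbX : ∀ i, Measurable fun ω => inner ℝ (b i) (X ω))
    {f : ι → Ω → ℝ} (hf : ∀ i, Measurable (f i))
    (h0 : ∀ i ω, |f i ω| ≤ |inner ℝ (b i) (X ω)|)
    (h1 : ∀ i j ω, |f i ω - f j ω| ≤ |inner ℝ (b i - b j) (X ω)|) (m : ℕ) (z : E) :
    ∫ S, maxExp (fun i => inner ℝ (b i) z + ∑ k, (∫ ω, f i ω ∂P - f i (S k)))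
        ∂(Measure.pi fun _ : Fin m => P) ≤
      Real.exp (√(1 + ‖B • z‖ ^ 2) + 4 * B ^ 2 * m) := by
  have hB : 0 ≤ B := (norm_nonneg _).trans (hb (Classical.arbitrary ι))
  have hg : ∀ i ω, |inner ℝ (b i) (X ω)| ≤ B := fun i ω => abs_inner_le_of_norm_le (hb i) (hX ω)
  have hfB : ∀ i ω, |f i ω| ≤ B := fun i ω => (h0 i ω).trans (hg i ω)
  have hz : ∀ (z : E) i, inner ℝ (b i) z ≤ B * ‖z‖ := fun z i =>
    (real_inner_le_norm _ _).trans (by gcongr; exact hb i)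
  have hdev : ∀ i ω, ∫ ω, f i ω ∂P - f i ω ≤ 2 * B := fun i ω => by
    linarith [(abs_le.1 (hfB i ω)).1, (abs_le.1 (abs_integral_le_of_abs_le P (hfB i))).2]
  have hsum : ∀ (n : ℕ) (S : Fin n → Ω) i,
      ∑ k, (∫ ω, f i ω ∂P - f i (S k)) ≤ n * (2 * B) := fun n S i => by
    simpa using Finset.sum_le_sum (s := Finset.univ) fun k _ => hdev i (S k)
  -- The vector `z` collects the linear terms of coordinates already contracted: each new one shifts
  -- it by ±2X(ω), and the potential inequality charges 4B² per coordinate.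
  induction m generalizing z with
  | zero =>
    have hle : maxExp (fun i => inner ℝ (b i) z) ≤ Real.exp (√(1 + ‖B • z‖ ^ 2)) := by
      refine maxExp_le_exp fun i => (hz z i).trans (Real.le_sqrt_of_sq_le ?_)
      rw [norm_smul, Real.norm_of_nonneg hB]
      linarith
    simpa using hle
  | succ m ih =>
    set Q := Measure.pi fun _ : Fin m => P with hQ
    set A : (Fin m → Ω) → ι → ℝ := fun T i =>
      inner ℝ (b i) z + ∑ k, (∫ ω, f i ω ∂P - f i (T k)) with hA
    have hAm : ∀ i, Measurable fun T => A T i := fun i => by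
      have := hf i
      simp only [hA]
      fun_prop
    have hAB : ∀ T i, A T i ≤ B * ‖z‖ + m * (2 * B) := fun T i =>
      add_le_add (hz z i) (hsum m T i)
    have j0 : Integrable (fun p : Ω × (Fin m → Ω) =>
        maxExp fun i => A p.2 i + ∫ ω, f i ω ∂P - f i p.1) (P.prod Q) := by
      refine integrable_maxExp _ (fun i => ?_) (B * ‖z‖ + m * (2 * B) + 2 * B) fun p i => ?_
      · have := hf i
        have := hAm i
        fun_prop
      · linarith [hAB p.2 i, hdev i p.1]
    have j1 : Integrable (fun p : Ω × (Fin m → Ω) =>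
        maxExp fun i => A p.2 i + 2 * inner ℝ (b i) (X p.1)) (P.prod Q) := by
      refine integrable_maxExp _ (fun i => ?_) (B * ‖z‖ + m * (2 * B) + 2 * B) fun p i => ?_
      · exact ((hAm i).comp measurable_snd).add (((hbX i).comp measurable_fst).const_mul 2)
      · linarith [hAB p.2 i, (abs_le.1 (hg i p.1)).2]
    have j2 : Integrable (fun p : Ω × (Fin m → Ω) =>
        maxExp fun i => A p.2 i - 2 * inner ℝ (b i) (X p.1)) (P.prod Q) := by
      refine integrable_maxExp _ (fun i => ?_) (B * ‖z‖ + m * (2 * B) + 2 * B) fun p i => ?_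
      · exact ((hAm i).comp measurable_snd).sub (((hbX i).comp measurable_fst).const_mul 2)
      · linarith [hAB p.2 i, (abs_le.1 (hg i p.1)).1]
    have j3 := (j1.add j2).const_mul (1 / 2)
    have hmp := (measurePreserving_piFinSuccAbove (fun _ : Fin (m + 1) => P) 0).symm
    rw [← hmp.integral_comp' (g := fun S : Fin (m + 1) → Ω =>
      maxExp fun i => inner ℝ (b i) z + ∑ k, (∫ ω, f i ω ∂P - f i (S k)))]
    have hcongr : ∀ p : Ω × (Fin m → Ω),
        (maxExp fun i => inner ℝ (b i) z + ∑ k, (∫ ω, f i ω ∂P -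
          f i ((MeasurableEquiv.piFinSuccAbove (fun _ : Fin (m + 1) => Ω) 0).symm p k))) =
        maxExp fun i => A p.2 i + ∫ ω, f i ω ∂P - f i p.1 := fun p => by
      congr 1
      funext i
      simp [Fin.sum_univ_succ, hA]
      ring
    simp only [hcongr]
    calc _ = ∫ T, ∫ ω, maxExp (fun i => A T i + ∫ ω, f i ω ∂P - f i ω) ∂P ∂Q :=
          integral_prod_symm _ j0
      _ ≤ ∫ T, ∫ ω, 1 / 2 * (maxExp (fun i => A T i + 2 * inner ℝ (b i) (X ω))
            + maxExp (fun i => A T i - 2 * inner ℝ (b i) (X ω))) ∂P ∂Q :=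
          integral_mono j0.integral_prod_right j3.integral_prod_right fun T =>
            integral_maxExp_symmetrize_le P (A T) hf hbX B hg h0
              (by simpa only [inner_sub_left] using h1)
      _ = ∫ ω, ∫ T, 1 / 2 * (maxExp (fun i => A T i + 2 * inner ℝ (b i) (X ω))
            + maxExp (fun i => A T i - 2 * inner ℝ (b i) (X ω))) ∂Q ∂P := by
          rw [← integral_prod_symm (fun p : Ω × (Fin m → Ω) => 1 / 2 *
            (maxExp (fun i => A p.2 i + 2 * inner ℝ (b i) (X p.1))
            + maxExp (fun i => A p.2 i - 2 * inner ℝ (b i) (X p.1)))) j3]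
          exact integral_prod _ j3
      _ ≤ ∫ ω, Real.exp (√(1 + ‖B • z‖ ^ 2) + 4 * B ^ 2 * (m + 1 : ℕ)) ∂P := by
          refine integral_mono j3.integral_prod_left (integrable_const _) fun ω => ?_
          have k1 : ∀ e : E, Integrable (fun T => maxExp fun i =>
              inner ℝ (b i) e + ∑ k, (∫ ω, f i ω ∂P - f i (T k))) Q := fun e => by
            refine integrable_maxExp _ (fun i => ?_) (B * ‖e‖ + m * (2 * B)) fun T i =>
              add_le_add (hz e i) (hsum m T i)
            have := hf i
            fun_prop
          have e1 : ∀ T, (maxExp fun i => A T i + 2 * inner ℝ (b i) (X ω)) =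
              maxExp fun i => inner ℝ (b i) (z + (2 : ℝ) • X ω) +
                ∑ k, (∫ ω, f i ω ∂P - f i (T k)) := fun T => by
            congr 1
            funext i
            rw [inner_add_right, real_inner_smul_right]
            ring
          have e2 : ∀ T, (maxExp fun i => A T i - 2 * inner ℝ (b i) (X ω)) =
              maxExp fun i => inner ℝ (b i) (z - (2 : ℝ) • X ω) +
                ∑ k, (∫ ω, f i ω ∂P - f i (T k)) := fun T => by
            congr 1
            funext i
            rw [inner_sub_right, real_inner_smul_right]
            ring
          simp only [e1, e2]
          rw [integral_const_mul, integral_add (k1 _) (k1 _)]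
          have hpot := exp_sqrt_potential_le (B := B) z (X ω) (hX ω)
          calc _ ≤ 1 / 2 * (Real.exp (√(1 + ‖B • (z + (2 : ℝ) • X ω)‖ ^ 2) + 4 * B ^ 2 * m)
                + Real.exp (√(1 + ‖B • (z - (2 : ℝ) • X ω)‖ ^ 2) + 4 * B ^ 2 * m)) := by
                gcongr
                · exact ih _
                · exact ih _
            _ = 1 / 2 * (Real.exp (√(1 + ‖B • (z + (2 : ℝ) • X ω)‖ ^ 2))
                + Real.exp (√(1 + ‖B • (z - (2 : ℝ) • X ω)‖ ^ 2))) *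
                  Real.exp (4 * B ^ 2 * m) := by
                rw [Real.exp_add, Real.exp_add]; ring
            _ ≤ Real.exp (√(1 + ‖B • z‖ ^ 2) + 4 * B ^ 2) * Real.exp (4 * B ^ 2 * m) := by
                gcongr
            _ = _ := by
                rw [← Real.exp_add]; push_cast; ring_nf
      _ = _ := by simp

/-- Uniform deviation bound for a finite family. -/
theorem measure_exists_finite_deviation_le {ι : Type*} [Finite ι] [Nonempty ι] (P : Measure Ω)
    [IsProbabilityMeasure P] {X : Ω → E} (hX : ∀ ω, ‖X ω‖ ≤ 1) {b : ι → E} {B : ℝ} (hB : 0 < B)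
    (hb : ∀ i, ‖b i‖ ≤ B) (hbX : ∀ i, Measurable fun ω => inner ℝ (b i) (X ω))
    {f : ι → Ω → ℝ} (hf : ∀ i, Measurable (f i))
    (h0 : ∀ i ω, |f i ω| ≤ |inner ℝ (b i) (X ω)|)
    (h1 : ∀ i j ω, |f i ω - f j ω| ≤ |inner ℝ (b i - b j) (X ω)|) (m : ℕ) {η : ℝ} (hη : 0 ≤ η) :
    (Measure.pi fun _ : Fin m => P).real
        {S | ∃ i, m * (B * η) < ∑ k, (∫ ω, f i ω ∂P - f i (S k))} ≤
      Real.exp (1 - m * η ^ 2 / 16) := by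
  -- This minimizes the Chernoff exponent 1 + 4l²B²m - lmBη over l.
  set l := η / (8 * B) with hl
  have hl0 : 0 ≤ l := by positivity
  have hlB : l * B = η / 8 := by rw [hl]; field_simp
  have hmgf := integral_maxExp_pi_le P hX (b := fun i => l • b i) (B := l * B)
    (fun i => by rw [norm_smul, Real.norm_of_nonneg hl0]; gcongr; exact hb i)
    (fun i => by simpa only [real_inner_smul_left] using (hbX i).const_mul l)
    (f := fun i ω => l * f i ω) (fun i => (hf i).const_mul l)
    (fun i ω => by
      rw [real_inner_smul_left, abs_mul, abs_mul]
      exact mul_le_mul_of_nonneg_left (h0 i ω) (abs_nonneg l))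
    (fun i j ω => by
      rw [← smul_sub, real_inner_smul_left, ← mul_sub, abs_mul, abs_mul]
      exact mul_le_mul_of_nonneg_left (h1 i j ω) (abs_nonneg l)) m 0
  simp only [inner_zero_right, zero_add, smul_zero, norm_zero, integral_const_mul, ← mul_sub,
    ← Finset.mul_sum] at hmgf
  set g : (Fin m → Ω) → ℝ := fun S =>
    maxExp fun i => l * ∑ k, (∫ ω, f i ω ∂P - f i (S k)) with hgdef
  have hgint : Integrable g (Measure.pi fun _ : Fin m => P) := by
    refine integrable_maxExp _ (fun i => ?_) (l * (m * (2 * B))) fun S i => ?_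
    · have := hf i
      fun_prop
    · have hfB : ∀ i ω, |f i ω| ≤ B := fun i ω =>
        (h0 i ω).trans (abs_inner_le_of_norm_le (hb i) (hX ω))
      have : ∑ k, (∫ ω, f i ω ∂P - f i (S k)) ≤ m * (2 * B) := by
        have := Finset.sum_le_sum (s := Finset.univ) (f := fun k => ∫ ω, f i ω ∂P - f i (S k))
          (g := fun _ => 2 * B) fun k _ => by
            linarith [(abs_le.1 (hfB i (S k))).1,
              (abs_le.1 (abs_integral_le_of_abs_le P (hfB i))).2]
        simpa using this
      gcongr
  have hmarkov := mul_meas_ge_le_integral_of_nonneg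
    (Filter.Eventually.of_forall fun S => maxExp_nonneg _) hgint (Real.exp (l * (m * (B * η))))
  have hsub : {S : Fin m → Ω | ∃ i, m * (B * η) < ∑ k, (∫ ω, f i ω ∂P - f i (S k))} ⊆
      {S | Real.exp (l * (m * (B * η))) ≤ g S} := by
    rintro S ⟨i, hi⟩
    refine le_trans (Real.exp_le_exp.2 ?_)
      (exp_le_maxExp (fun i => l * ∑ k, (∫ ω, f i ω ∂P - f i (S k))) i)
    gcongr
  have h2 : Real.exp (l * (m * (B * η))) * (Measure.pi fun _ : Fin m => P).real
      {S | ∃ i, m * (B * η) < ∑ k, (∫ ω, f i ω ∂P - f i (S k))} ≤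
      Real.exp (l * (m * (B * η))) * Real.exp (1 - m * η ^ 2 / 16) := by
    calc _ ≤ Real.exp (l * (m * (B * η))) * (Measure.pi fun _ : Fin m => P).real
          {S | Real.exp (l * (m * (B * η))) ≤ g S} := by
          exact mul_le_mul_of_nonneg_left (measureReal_mono hsub) (Real.exp_pos _).le
      _ ≤ _ := hmarkov
      _ ≤ _ := hmgf
      _ = _ := by
        rw [← Real.exp_add, show l * (m * (B * η)) = m * η * (l * B) by ring, hlB]
        congr 1
        norm_num
        ring
  exact le_of_mul_le_mul_left h2 (Real.exp_pos _)

/-- The finite bound does not involve the size of the family, so continuity from below along initial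
segments preserves it. -/
theorem measure_exists_seq_deviation_le (P : Measure Ω)
    [IsProbabilityMeasure P] {X : Ω → E} (hX : ∀ ω, ‖X ω‖ ≤ 1) {b : ℕ → E} {B : ℝ} (hB : 0 < B)
    (hb : ∀ i, ‖b i‖ ≤ B) (hbX : ∀ i, Measurable fun ω => inner ℝ (b i) (X ω))
    {f : ℕ → Ω → ℝ} (hf : ∀ i, Measurable (f i))
    (h0 : ∀ i ω, |f i ω| ≤ |inner ℝ (b i) (X ω)|)
    (h1 : ∀ i j ω, |f i ω - f j ω| ≤ |inner ℝ (b i - b j) (X ω)|) (m : ℕ) {η : ℝ} (hη : 0 ≤ η) :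
    (Measure.pi fun _ : Fin m => P).real
        {S | ∃ i, m * (B * η) < ∑ k, (∫ ω, f i ω ∂P - f i (S k))} ≤
      Real.exp (1 - m * η ^ 2 / 16) := by
  set s : ℕ → Set (Fin m → Ω) := fun n =>
    {S | ∃ i : Fin (n + 1), m * (B * η) < ∑ k, (∫ ω, f i ω ∂P - f i (S k))} with hs
  have hmono : Monotone s := by
    rintro n n' hn S ⟨i, hi⟩
    exact ⟨Fin.castLE (by omega) i, hi⟩
  have hunion : {S | ∃ i, m * (B * η) < ∑ k, (∫ ω, f i ω ∂P - f i (S k))} = ⋃ n, s n := by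
    ext S
    simp only [hs, Set.mem_ofPred_eq, Set.mem_iUnion]
    constructor
    · rintro ⟨i, hi⟩
      exact ⟨i, Fin.last i, hi⟩
    · rintro ⟨n, i, hi⟩
      exact ⟨i, hi⟩
  rw [hunion]
  have htend := tendsto_measure_iUnion_atTop (μ := Measure.pi fun _ : Fin m => P) hmono
  refine ENNReal.toReal_le_of_le_ofReal (Real.exp_pos _).le (le_of_tendsto' htend fun n => ?_)
  refine (ENNReal.le_ofReal_iff_toReal_le (measure_ne_top _ _) (Real.exp_pos _).le).2 ?_
  exact measure_exists_finite_deviation_le P hX hB (b := fun i : Fin (n + 1) => b i)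
    (fun i => hb i) (fun i => hbX i) (f := fun i : Fin (n + 1) => f i) (fun i => hf i)
    (fun i => h0 i) (fun i j => h1 i j) m hη

/-- Uniform deviation bound over a ball, for functions indexed nonexpansively by it. -/
theorem measure_exists_ball_deviation_le [TopologicalSpace.SeparableSpace E] (P : Measure Ω)
    [IsProbabilityMeasure P] {X : Ω → E} (hX : ∀ ω, ‖X ω‖ ≤ 1)
    (hbX : ∀ b : E, Measurable fun ω => inner ℝ b (X ω)) {f : E → Ω → ℝ}
    (hf : ∀ b, Measurable (f b)) (h0 : ∀ ω, f 0 ω = 0)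
    (h1 : ∀ b b' ω, |f b ω - f b' ω| ≤ |inner ℝ (b - b') (X ω)|) {B : ℝ} (hB : 0 ≤ B) (m : ℕ)
    {η : ℝ} (hη : 0 ≤ η) :
    (Measure.pi fun _ : Fin m => P).real
        {S | ∃ b : E, ‖b‖ ≤ B ∧ m * (B * η) < ∑ k, (∫ ω, f b ω ∂P - f b (S k))} ≤
      Real.exp (1 - m * η ^ 2 / 16) := by
  have h0' : ∀ b ω, |f b ω| ≤ |inner ℝ b (X ω)| := fun b ω => by
    simpa [h0] using h1 b 0 ω
  -- Radius zero is separate because the Chernoff parameter divides by B; there only b = 0 remains,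
  -- with zero deviation.
  rcases hB.eq_or_lt with rfl | hB
  · have : {S : Fin m → Ω | ∃ b : E, ‖b‖ ≤ 0 ∧
        m * (0 * η) < ∑ k, (∫ ω, f b ω ∂P - f b (S k))} = ∅ := by
      ext S
      simp only [Set.mem_ofPred_eq, Set.mem_empty_iff_false, iff_false]
      rintro ⟨b, hb, h⟩
      rw [norm_le_zero_iff] at hb
      subst hb
      simp [h0] at h
    rw [this, measureReal_empty]
    exact (Real.exp_pos _).le
  have hLip : ∀ b b' ω, |f b ω - f b' ω| ≤ ‖b - b'‖ := fun b b' ω =>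
    (h1 b b' ω).trans (abs_inner_le_of_norm_le le_rfl (hX ω))
  have hint : ∀ b, Integrable (f b) P := fun b =>
    Integrable.of_bound (hf b).aestronglyMeasurable ‖b‖ (Filter.Eventually.of_forall fun ω =>
      (h0' b ω).trans (abs_inner_le_of_norm_le le_rfl (hX ω)))
  have hcf : ∀ ω, Continuous fun b => f b ω := fun ω =>
    (LipschitzWith.of_dist_le_mul (K := 1) fun b b' => by
      simpa [Real.dist_eq, dist_eq_norm] using hLip b b' ω).continuous
  have hcI : Continuous fun b => ∫ ω, f b ω ∂P :=
    (LipschitzWith.of_dist_le_mul (K := 1) fun b b' => by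
      rw [Real.dist_eq, ← integral_sub (hint b) (hint b')]
      simpa [dist_eq_norm] using abs_integral_le_of_abs_le P (hLip b b')).continuous
  have : Nonempty (Metric.closedBall (0 : E) B) := ⟨⟨0, by simp [hB.le]⟩⟩
  set c : ℕ → Metric.closedBall (0 : E) B := TopologicalSpace.denseSeq _ with hc
  have hden : DenseRange c := TopologicalSpace.denseRange_denseSeq _
  refine le_trans (measureReal_mono ?_) (measure_exists_seq_deviation_le P hX hB
    (b := fun n => (c n : E)) (fun n => mem_closedBall_zero_iff.1 (c n).2) (fun n => hbX _)
    (f := fun n => f (c n)) (fun n => hf _) (fun n => h0' _) (fun i j => h1 _ _) m hη)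
  -- The deviation is continuous in b and the inequality strict, so a violation anywhere in the ball
  -- forces one on the dense sequence.
  rintro S ⟨b, hb, h⟩
  have hcont : Continuous fun b : Metric.closedBall (0 : E) B =>
      ∑ k, (∫ ω, f b ω ∂P - f b (S k)) :=
    continuous_finsetSum _ fun k _ =>
      (hcI.comp continuous_subtype_val).sub ((hcf (S k)).comp continuous_subtype_val)
  obtain ⟨n, hn⟩ := hden.exists_mem_open (isOpen_lt continuous_const hcont)
    ⟨⟨b, by simpa using hb⟩, h⟩
  exact ⟨n, hn⟩

end Concentration

/-! ### Deterministic analysis of the iteration. -/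

theorem abs_sub_le_of_lipschitzWith_one {u : ℝ → ℝ} (hu : LipschitzWith 1 u) (a b : ℝ) :
    |u a - u b| ≤ |a - b| := by
  simpa [Real.dist_eq] using hu.dist_le_mul a b

/-- Monotonicity gives u(a) - u(b) the sign of a - b, and the Lipschitz bound makes it no larger in
size. This is what makes the signal point towards `w`. -/
theorem sq_sub_le_mul_sub {u : ℝ → ℝ} (hm : Monotone u) (hu : LipschitzWith 1 u) (a b : ℝ) :
    (u a - u b) ^ 2 ≤ (a - b) * (u a - u b) := by
  have h := abs_sub_le_of_lipschitzWith_one hu a b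
  rcases le_total a b with hab | hab
  · have h1 := hm hab
    rw [abs_of_nonpos (by linarith), abs_of_nonpos (by linarith)] at h
    nlinarith
  · have h1 := hm hab
    rw [abs_of_nonneg (by linarith), abs_of_nonneg (by linarith)] at h
    nlinarith

section

variable {d m : ℕ}

/-- The mean of `(y_i - u (w ⬝ x_i)) x_i` over the sample. -/
noncomputable def noise (u : ℝ → ℝ) (w : EuclideanSpace ℝ (Fin d)) (S : Fin m → Point d) :
    EuclideanSpace ℝ (Fin d) :=
  (1 / (m : ℝ)) • ∑ i, ((S i).2 - u (inner ℝ w (S i).1)) • (S i).1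

theorem step_eq_add_noise (u : ℝ → ℝ) (S : Fin m → Point d) (v : EuclideanSpace ℝ (Fin d)) :
    step u S v = v + noise u v S := rfl

theorem norm_sq_mean_smul_le {E : Type*} [NormedAddCommGroup E] [NormedSpace ℝ E]
    (a : Fin m → ℝ) (x : Fin m → E) (hx : ∀ i, ‖x i‖ ≤ 1) :
    ‖(1 / (m : ℝ)) • ∑ i, a i • x i‖ ^ 2 ≤ 1 / (m : ℝ) * ∑ i, a i ^ 2 := by
  have h1 : ‖∑ i, a i • x i‖ ≤ ∑ i, |a i| :=
    (norm_sum_le _ _).trans (Finset.sum_le_sum fun i _ => by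
      rw [norm_smul, Real.norm_eq_abs]
      exact mul_le_of_le_one_right (abs_nonneg _) (hx i))
  have h2 : (∑ i, |a i|) ^ 2 ≤ m * ∑ i, a i ^ 2 := by
    simpa using sq_sum_le_card_mul_sum_sq (s := Finset.univ) (f := fun i => |a i|)
  rcases Nat.eq_zero_or_pos m with rfl | hm
  · simp
  have hm' : (0 : ℝ) < m := Nat.cast_pos.2 hm
  rw [norm_smul, Real.norm_of_nonneg (by positivity), mul_pow]
  calc _ ≤ (1 / (m : ℝ)) ^ 2 * (m * ∑ i, a i ^ 2) := by
        gcongr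
        exact le_trans (by gcongr) h2
    _ = _ := by field_simp

/-- One GLM-tron step moves towards `w` while the fixed design error dominates the noise. -/
theorem norm_sq_step_sub_le {u : ℝ → ℝ} (hm : Monotone u) (hu : LipschitzWith 1 u)
    (S : Fin m → Point d) (hS : ∀ i, ‖(S i).1‖ ≤ 1) (v w : EuclideanSpace ℝ (Fin d)) {W η : ℝ}
    (hη : ‖noise u w S‖ ≤ η) (hηW : η ≤ W) (hv : ‖v - w‖ ≤ W) :
    ‖step u S v - w‖ ^ 2 ≤ ‖v - w‖ ^ 2
      - 1 / 2 * empExcessErr u w S (fun x => u (inner ℝ v x)) + 5 * (W * η) := by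
  set e := empExcessErr u w S (fun x => u (inner ℝ v x)) with he
  set a : Fin m → ℝ := fun i => u (inner ℝ w (S i).1) - u (inner ℝ v (S i).1) with ha
  set g := (1 / (m : ℝ)) • ∑ i, a i • (S i).1 with hg
  have hae : e = 1 / (m : ℝ) * ∑ i, a i ^ 2 := by
    simp only [he, empExcessErr, ha]
    congr 1
    exact Finset.sum_congr rfl fun i _ => by ring
  have he0 : 0 ≤ e := by rw [hae]; positivity
  have hη0 : 0 ≤ η := (norm_nonneg _).trans hη
  have hdecomp : step u S v - w = (v - w) + (g + noise u w S) := by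
    have : noise u v S = g + noise u w S := by
      simp only [noise, hg, ha, ← smul_add, ← Finset.sum_add_distrib, ← add_smul]
      congr 1
      exact Finset.sum_congr rfl fun i _ => by congr 1; ring
    rw [step_eq_add_noise, this]
    abel
  have hgn : ‖g‖ ^ 2 ≤ e := by
    rw [hae]
    exact norm_sq_mean_smul_le a _ hS
  have hgi : inner ℝ (v - w) g ≤ -e := by
    rw [hg, real_inner_smul_right, inner_sum, hae, ← mul_neg, ← Finset.sum_neg_distrib]
    gcongr with i
    rw [real_inner_smul_right, inner_sub_left]
    have := sq_sub_le_mul_sub hm hu (inner ℝ w (S i).1) (inner ℝ v (S i).1)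
    simp only [ha]
    linarith
  have hni : inner ℝ (v - w) (noise u w S) ≤ W * η :=
    (real_inner_le_norm _ _).trans
      (mul_le_mul hv hη (norm_nonneg _) ((norm_nonneg _).trans hv))
  have hgn' : inner ℝ g (noise u w S) ≤ ‖g‖ * η :=
    (real_inner_le_norm _ _).trans (by gcongr)
  have hnn : ‖noise u w S‖ ^ 2 ≤ η ^ 2 := by gcongr
  rw [hdecomp, norm_add_sq_real, norm_add_sq_real, inner_add_right]
  -- The hint gives 2‖g‖η ≤ ‖g‖²/2 + 2η². The error then has coefficient -2 + 1 + 1/2, and the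
  -- remainder 2Wη + 3η² is at most 5Wη because η ≤ W.
  nlinarith [sq_nonneg (‖g‖ - 2 * η)]

/-- GLM-tron reaches a small fixed design error before leaving the ball around `w`. -/
theorem exists_weight_empExcessErr_le {u : ℝ → ℝ} (hm : Monotone u) (hu : LipschitzWith 1 u)
    (S : Fin m → Point d) (hS : ∀ i, ‖(S i).1‖ ≤ 1) (w : EuclideanSpace ℝ (Fin d)) {W η : ℝ}
    (hw : ‖w‖ ≤ W) (hη0 : 0 < η) (hη : ‖noise u w S‖ ≤ η) :
    ∃ t : ℕ, 1 ≤ t ∧ (t = 1 ∨ (0 < W ∧ (t : ℝ) ≤ 2 * (W / η))) ∧ ‖weight u S t - w‖ ≤ W ∧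
      empExcessErr u w S (hyp u S t) ≤ 12 * (W * η) := by
  have hW : 0 ≤ W := (norm_nonneg _).trans hw
  rcases lt_or_ge W η with hWη | hηW
  · refine ⟨1, le_rfl, Or.inl rfl, by simpa [weight_one] using hw, ?_⟩
    have hterm : ∀ i, (hyp u S 1 (S i).1 - u (inner ℝ w (S i).1)) ^ 2 ≤ W ^ 2 := fun i => by
      have h1 := abs_sub_le_of_lipschitzWith_one hu 0 (inner ℝ w (S i).1)
      have h2 : |inner ℝ w (S i).1| ≤ W := (abs_real_inner_le_norm _ _).trans
        (le_trans (mul_le_mul hw (hS i) (norm_nonneg _) hW) (mul_one W).le)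
      rw [hyp, weight_one, inner_zero_left, ← sq_abs]
      gcongr
      simpa using h1.trans (by simpa using h2)
    have hle : empExcessErr u w S (hyp u S 1) ≤ W ^ 2 := by
      unfold empExcessErr
      calc _ ≤ 1 / (m : ℝ) * ∑ _i : Fin m, W ^ 2 := by
            exact mul_le_mul_of_nonneg_left (Finset.sum_le_sum fun i _ => hterm i) (by positivity)
        _ ≤ W ^ 2 := by
            rcases Nat.eq_zero_or_pos m with rfl | hm
            · simp; positivity
            · have : (m : ℝ) ≠ 0 := by positivity
              simp
              field_simp
              rfl
    nlinarith
  have hWpos : 0 < W := hη0.trans_le hηW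
  by_contra! hcon
  -- If every admissible error exceeds 12Wη, a step loses more than 6Wη and regains at most 5Wη.
  have key : ∀ n : ℕ, (n : ℝ) ≤ W / η →
      ‖weight u S (n + 1) - w‖ ^ 2 ≤ W ^ 2 - n * (W * η) := by
    intro n
    induction n with
    | zero => intro _; simpa [weight_one] using pow_le_pow_left₀ (norm_nonneg _) hw 2
    | succ n ih =>
      intro hn
      push_cast at hn ⊢
      have ih' := ih (by linarith)
      have hball : ‖weight u S (n + 1) - w‖ ≤ W := by
        refine abs_le_of_sq_le_sq' ?_ hW |>.2
        have : 0 ≤ n * (W * η) := by positivity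
        linarith
      have hbig := hcon (n + 1) (by omega) (by
        rcases Nat.eq_zero_or_pos n with rfl | h
        · exact Or.inl rfl
        · refine Or.inr ⟨hWpos, ?_⟩
          push_cast
          have : 0 ≤ W / η := by positivity
          linarith) hball
      have hs := norm_sq_step_sub_le hm hu S hS (weight u S (n + 1)) w hη hηW hball
      have hw' : weight u S (n + 1 + 1) = step u S (weight u S (n + 1)) :=
        weight_succ u S (by omega)
      rw [hw']
      have : empExcessErr u w S (hyp u S (n + 1)) =
        empExcessErr u w S (fun x => u (inner ℝ (weight u S (n + 1)) x)) := rfl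
      linarith
  -- Iterate n + 1 is still admissible, since W/η ≥ 1 gives n + 1 ≤ 2W/η. One more step would make
  -- the squared distance negative, as n + 1 > W/η.
  set n := ⌊W / η⌋₊ with hn
  have hnle : (n : ℝ) ≤ W / η := Nat.floor_le (by positivity)
  have hn1 : 1 ≤ n := Nat.one_le_floor_iff _ |>.2 ((one_le_div hη0).2 hηW)
  have hlt : W / η < n + 1 := Nat.lt_floor_add_one _
  have hk := key n hnle
  have hn1' : (1 : ℝ) ≤ n := by exact_mod_cast hn1
  have hball : ‖weight u S (n + 1) - w‖ ≤ W := by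
    refine abs_le_of_sq_le_sq' ?_ hW |>.2
    have : 0 ≤ n * (W * η) := by positivity
    linarith
  have hbig := hcon (n + 1) (by omega) (Or.inr ⟨hWpos, by push_cast; linarith⟩) hball
  have hs := norm_sq_step_sub_le hm hu S hS (weight u S (n + 1)) w hη hηW hball
  have : empExcessErr u w S (hyp u S (n + 1)) =
    empExcessErr u w S (fun x => u (inner ℝ (weight u S (n + 1)) x)) := rfl
  have h0 := sq_nonneg ‖step u S (weight u S (n + 1)) - w‖
  have : W * W < (n + 1) * η * W := by
    rw [div_lt_iff₀ hη0] at hlt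
    exact mul_lt_mul_of_pos_right hlt hWpos
  nlinarith

end

/-! ### Conditional expectation and excess error. -/

section

variable {d : ℕ} {D : Measure (Point d)} [IsProbabilityMeasure D] {u : ℝ → ℝ}
  {w : EuclideanSpace ℝ (Fin d)}

theorem integral_mul_sub_regression_eq_zero (hu : Continuous u) (hu1 : ∀ z, u z ∈ Set.Icc (0 : ℝ) 1)
    (hD : ∀ᵐ p ∂D, ‖p.1‖ ≤ 1 ∧ p.2 ∈ Set.Icc (0 : ℝ) 1)
    (hr : regression D =ᵐ[D] fun p => u (inner ℝ w p.1)) {g : EuclideanSpace ℝ (Fin d) → ℝ}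
    (hg : Measurable g) {C : ℝ} (hC : ∀ᵐ p ∂D, |g p.1| ≤ C) :
    ∫ p, g p.1 * (p.2 - u (inner ℝ w p.1)) ∂D = 0 := by
  have hle : MeasurableSpace.comap (Prod.fst : Point d → _) inferInstance ≤
      (inferInstance : MeasurableSpace (Point d)) := measurable_fst.comap_le
  have hy : Integrable (fun p : Point d => p.2) D := by
    refine Integrable.of_bound measurable_snd.aestronglyMeasurable 1 ?_
    filter_upwards [hD] with p hp
    rw [Real.norm_of_nonneg hp.2.1]
    exact hp.2.2
  have hgs : StronglyMeasurable[MeasurableSpace.comap (Prod.fst : Point d → _) inferInstance]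
      fun p : Point d => g p.1 :=
    (hg.comp (comap_measurable _)).stronglyMeasurable
  have hpull := condExp_stronglyMeasurable_mul_of_bound hle hgs hy C hC
  have hgy : Integrable (fun p : Point d => g p.1 * p.2) D :=
    hy.bdd_mul (hg.comp measurable_fst).aestronglyMeasurable hC
  have hum : Measurable fun p : Point d => u (inner ℝ w p.1) := by
    have := hu.measurable
    fun_prop
  have hub : Integrable (fun p : Point d => u (inner ℝ w p.1)) D := by
    refine Integrable.of_bound hum.aestronglyMeasurable 1 (Filter.Eventually.of_forall fun p => ?_)
    rw [Real.norm_of_nonneg (hu1 _).1]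
    exact (hu1 _).2
  have hgu : Integrable (fun p : Point d => g p.1 * u (inner ℝ w p.1)) D :=
    hub.bdd_mul (hg.comp measurable_fst).aestronglyMeasurable hC
  have h1 : ∫ p : Point d, g p.1 * p.2 ∂D = ∫ p : Point d, g p.1 * u (inner ℝ w p.1) ∂D := by
    rw [← integral_condExp hle]
    refine integral_congr_ae ?_
    filter_upwards [hpull, hr] with p hp hrp
    exact hp.trans (congrArg (g p.1 * ·) hrp)
  simp only [mul_sub]
  rw [integral_sub hgy hgu, h1, sub_self]

/-- Pythagoras in L²: the residual y - u(w·x) is orthogonal to bounded functions of x, so the cross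
term vanishes. -/
theorem excessErr_eq (hu : Continuous u) (hu1 : ∀ z, u z ∈ Set.Icc (0 : ℝ) 1)
    (hD : ∀ᵐ p ∂D, ‖p.1‖ ≤ 1 ∧ p.2 ∈ Set.Icc (0 : ℝ) 1)
    (hr : regression D =ᵐ[D] fun p => u (inner ℝ w p.1)) {h : EuclideanSpace ℝ (Fin d) → ℝ}
    (hh : Measurable h) (h1 : ∀ x, h x ∈ Set.Icc (0 : ℝ) 1) :
    excessErr D h = ∫ p, (h p.1 - u (inner ℝ w p.1)) ^ 2 ∂D := by
  have hum : Measurable fun x : EuclideanSpace ℝ (Fin d) => u (inner ℝ w x) := by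
    have := hu.measurable
    fun_prop
  have hcross := integral_mul_sub_regression_eq_zero (g := fun x => h x - u (inner ℝ w x)) hu hu1 hD
    hr (hh.sub hum) (C := 1) (Filter.Eventually.of_forall fun p => by
      rw [abs_le]
      constructor <;> linarith [(h1 p.1).1, (h1 p.1).2, (hu1 (inner ℝ w p.1)).1,
        (hu1 (inner ℝ w p.1)).2])
  have hsq : ∀ {f : Point d → ℝ}, Measurable f → (∀ᵐ p ∂D, |f p| ≤ 1) →
      Integrable (fun p => f p ^ 2) D := fun {f} hf hb => by
    refine Integrable.of_bound (hf.pow_const 2).aestronglyMeasurable 1 ?_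
    filter_upwards [hb] with p hp
    rw [Real.norm_of_nonneg (sq_nonneg _), ← sq_abs]
    exact pow_le_one₀ (abs_nonneg _) hp
  have i1 : Integrable (fun p : Point d => (h p.1 - p.2) ^ 2) D := by
    refine hsq (f := fun p => h p.1 - p.2) (by fun_prop) ?_
    filter_upwards [hD] with p hp
    rw [abs_le]
    constructor <;> linarith [(h1 p.1).1, (h1 p.1).2, hp.2.1, hp.2.2]
  have i2 : Integrable (fun p : Point d => (u (inner ℝ w p.1) - p.2) ^ 2) D := by
    refine hsq (f := fun p => u (inner ℝ w p.1) - p.2) (by fun_prop) ?_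
    filter_upwards [hD] with p hp
    rw [abs_le]
    constructor <;> linarith [(hu1 (inner ℝ w p.1)).1, (hu1 (inner ℝ w p.1)).2, hp.2.1, hp.2.2]
  have i3 : Integrable (fun p : Point d => (h p.1 - u (inner ℝ w p.1)) ^ 2) D := by
    refine hsq (f := fun p => h p.1 - u (inner ℝ w p.1)) (by fun_prop) ?_
    filter_upwards with p
    rw [abs_le]
    constructor <;> linarith [(hu1 (inner ℝ w p.1)).1, (hu1 (inner ℝ w p.1)).2, (h1 p.1).1,
      (h1 p.1).2]
  have hreg : ∫ p, (regression D p - p.2) ^ 2 ∂D =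
      ∫ p, (u (inner ℝ w p.1) - p.2) ^ 2 ∂D := by
    refine integral_congr_ae ?_
    filter_upwards [hr] with p hp
    rw [hp]
  have e : ∀ p : Point d, (h p.1 - u (inner ℝ w p.1)) * (p.2 - u (inner ℝ w p.1)) =
      1 / 2 * ((h p.1 - u (inner ℝ w p.1)) ^ 2 - ((h p.1 - p.2) ^ 2
        - (u (inner ℝ w p.1) - p.2) ^ 2)) := fun p => by ring
  simp only [e] at hcross
  have i12 : Integrable (fun p : Point d => (h p.1 - p.2) ^ 2 - (u (inner ℝ w p.1) - p.2) ^ 2) D :=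
    i1.sub i2
  rw [integral_const_mul, integral_sub i3 i12, integral_sub i1 i2] at hcross
  rw [excessErr, err, hreg]
  linarith

end

/-! ### The two high-probability events. -/

section

variable {d : ℕ}

/-- The labelled points with `x` in the unit ball and `y ∈ [0, 1]`. -/
def domain (d : ℕ) : Set (Point d) := {p | ‖p.1‖ ≤ 1 ∧ p.2 ∈ Set.Icc (0 : ℝ) 1}

theorem measurableSet_domain : MeasurableSet (domain d) :=
  (measurableSet_le measurable_fst.norm measurable_const).inter
    (measurableSet_Icc.preimage measurable_snd)

/-- The deviation bounds need pointwise control, while the support condition holds only almost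
surely; truncating to `domain d` bridges the two without changing integrals. -/
theorem norm_indicator_fst_le (p : Point d) : ‖(domain d).indicator Prod.fst p‖ ≤ 1 := by
  by_cases hp : p ∈ domain d
  · rw [Set.indicator_of_mem hp]; exact hp.1
  · rw [Set.indicator_of_notMem hp]; simp

theorem measurable_inner_indicator_fst (b : EuclideanSpace ℝ (Fin d)) :
    Measurable fun p : Point d => inner ℝ b ((domain d).indicator Prod.fst p) :=
  measurable_const.inner (measurable_fst.indicator measurableSet_domain)

theorem integral_indicator_domain {D : Measure (Point d)} (hD : ∀ᵐ p ∂D, p ∈ domain d)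
    (f : Point d → ℝ) : ∫ p, (domain d).indicator f p ∂D = ∫ p, f p ∂D := by
  refine integral_congr_ae ?_
  filter_upwards [hD] with p hp
  rw [Set.indicator_of_mem hp]

variable {u : ℝ → ℝ} {w : EuclideanSpace ℝ (Fin d)} {D : Measure (Point d)}
  [IsProbabilityMeasure D]

/-- By duality the noise norm is a supremum over the unit ball of sample averages of (b·x)(y -
u(w·x)), which have mean zero. The minus sign in `f` matches the mean-minus-sample form of the
deviation. -/
theorem measure_noise_gt_le (hu : Continuous u) (hu1 : ∀ z, u z ∈ Set.Icc (0 : ℝ) 1)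
    (hD : ∀ᵐ p ∂D, p ∈ domain d)
    (hr : regression D =ᵐ[D] fun p => u (inner ℝ w p.1)) (m : ℕ) {η : ℝ} (hη : 0 ≤ η) :
    (Measure.pi fun _ : Fin m => D).real
      {S | (∀ k, S k ∈ domain d) ∧ η < ‖noise u w S‖} ≤ Real.exp (1 - m * η ^ 2 / 16) := by
  set f : EuclideanSpace ℝ (Fin d) → Point d → ℝ := fun b =>
    (domain d).indicator fun p => -(inner ℝ b p.1 * (p.2 - u (inner ℝ w p.1))) with hf
  have hum := hu.measurable
  have hfm : ∀ b, Measurable (f b) := fun b =>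
    Measurable.indicator (by fun_prop) measurableSet_domain
  have hf1 : ∀ b b' p, |f b p - f b' p| ≤
      |inner ℝ (b - b') ((domain d).indicator Prod.fst p)| := fun b b' p => by
    by_cases hp : p ∈ domain d
    · simp only [hf, Set.indicator_of_mem hp]
      have e : -(inner ℝ b p.1 * (p.2 - u (inner ℝ w p.1))) -
          -(inner ℝ b' p.1 * (p.2 - u (inner ℝ w p.1))) =
          -(inner ℝ (b - b') p.1 * (p.2 - u (inner ℝ w p.1))) := by
        rw [inner_sub_left]; ring
      rw [e, abs_neg, abs_mul]
      refine mul_le_of_le_one_right (abs_nonneg _) (abs_le.2 ?_)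
      constructor <;> linarith [hp.2.1, hp.2.2, (hu1 (inner ℝ w p.1)).1, (hu1 (inner ℝ w p.1)).2]
    · simp [hf, Set.indicator_of_notMem hp]
  have hint : ∀ b, ∫ p, f b p ∂D = 0 := fun b => by
    rw [hf, integral_indicator_domain hD, integral_neg, integral_mul_sub_regression_eq_zero
      (g := fun x => inner ℝ b x) hu hu1 hD hr (by fun_prop) (C := ‖b‖), neg_zero]
    filter_upwards [hD] with p hp
    exact abs_inner_le_of_norm_le le_rfl hp.1
  have hmain := measure_exists_ball_deviation_le D norm_indicator_fst_le
    measurable_inner_indicator_fst hfm (fun p => by simp [hf]) hf1 zero_le_one m hη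
  refine le_trans (measureReal_mono ?_) hmain
  rintro S ⟨hS, hlt⟩
  have hpos : 0 < ‖noise u w S‖ := hη.trans_lt hlt
  refine ⟨‖noise u w S‖⁻¹ • noise u w S, ?_, ?_⟩
  · rw [norm_smul, norm_inv, norm_norm, inv_mul_cancel₀ hpos.ne']
  · have hm : 0 < (m : ℝ) := by
      rcases Nat.eq_zero_or_pos m with rfl | h
      · simp [noise] at hpos
      · exact Nat.cast_pos.2 h
    set b := ‖noise u w S‖⁻¹ • noise u w S with hb
    have e1 : ∑ k, (∫ p, f b p ∂D - f b (S k)) = m * inner ℝ b (noise u w S) := by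
      rw [noise, real_inner_smul_right, inner_sum, ← mul_assoc, mul_one_div_cancel hm.ne', one_mul]
      refine Finset.sum_congr rfl fun k _ => ?_
      rw [hint, real_inner_smul_right]
      simp only [hf, Set.indicator_of_mem (hS k)]
      ring
    have e2 : inner ℝ b (noise u w S) = ‖noise u w S‖ := by
      rw [hb, real_inner_smul_left, real_inner_self_eq_norm_sq]
      field_simp
    rw [e1, e2, one_mul]
    gcongr

theorem measure_excessErr_deviation_le (hu : LipschitzWith 1 u)
    (hu1 : ∀ z, u z ∈ Set.Icc (0 : ℝ) 1) (hD : ∀ᵐ p ∂D, p ∈ domain d)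
    (hr : regression D =ᵐ[D] fun p => u (inner ℝ w p.1)) {W : ℝ} (hW : 0 ≤ W) (m : ℕ) {η : ℝ}
    (hη : 0 ≤ η) :
    (Measure.pi fun _ : Fin m => D).real
      {S | (∀ k, S k ∈ domain d) ∧ ∃ v, ‖v - w‖ ≤ W ∧
        m * (2 * W * η) < m * (excessErr D (fun x => u (inner ℝ v x)) -
          empExcessErr u w S (fun x => u (inner ℝ v x)))} ≤ Real.exp (1 - m * η ^ 2 / 16) := by
  -- Differences of these squares factor with one factor at most 2; the scaling b/2 compensates, so
  -- increments are dominated by |(b - b')·x|. The ball of radius W about `w` becomes b-radius 2W.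
  set f : EuclideanSpace ℝ (Fin d) → Point d → ℝ := fun b =>
    (domain d).indicator fun p =>
      (u (inner ℝ (w + (1 / 2 : ℝ) • b) p.1) - u (inner ℝ w p.1)) ^ 2 with hf
  have hum := hu.continuous.measurable
  have hfm : ∀ b, Measurable (f b) := fun b =>
    Measurable.indicator (by fun_prop) measurableSet_domain
  have hf1 : ∀ b b' p, |f b p - f b' p| ≤
      |inner ℝ (b - b') ((domain d).indicator Prod.fst p)| := fun b b' p => by
    by_cases hp : p ∈ domain d
    · simp only [hf, Set.indicator_of_mem hp]
      set s := u (inner ℝ (w + (1 / 2 : ℝ) • b) p.1) with hs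
      set s' := u (inner ℝ (w + (1 / 2 : ℝ) • b') p.1) with hs'
      set r := u (inner ℝ w p.1)
      have h1 : |s - s'| ≤ 1 / 2 * |inner ℝ (b - b') p.1| := by
        refine (abs_sub_le_of_lipschitzWith_one hu _ _).trans (le_of_eq ?_)
        rw [← inner_sub_left, add_sub_add_left_eq_sub, ← smul_sub, real_inner_smul_left, abs_mul,
          abs_of_pos (by norm_num : (0 : ℝ) < 1 / 2)]
      have h2 : |s + s' - 2 * r| ≤ 2 := by
        rw [abs_le]
        constructor <;> linarith [(hu1 (inner ℝ (w + (1 / 2 : ℝ) • b) p.1)).1,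
          (hu1 (inner ℝ (w + (1 / 2 : ℝ) • b) p.1)).2,
          (hu1 (inner ℝ (w + (1 / 2 : ℝ) • b') p.1)).1,
          (hu1 (inner ℝ (w + (1 / 2 : ℝ) • b') p.1)).2, (hu1 (inner ℝ w p.1)).1,
          (hu1 (inner ℝ w p.1)).2]
      calc |(s - r) ^ 2 - (s' - r) ^ 2| = |s - s'| * |s + s' - 2 * r| := by
            rw [← abs_mul]; ring_nf
        _ ≤ 1 / 2 * |inner ℝ (b - b') p.1| * 2 := by gcongr
        _ = _ := by ring
    · simp [hf, Set.indicator_of_notMem hp]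
  have hmain := measure_exists_ball_deviation_le D norm_indicator_fst_le
    measurable_inner_indicator_fst hfm (fun p => by simp [hf]) hf1
    (mul_nonneg zero_le_two hW) m hη
  refine le_trans (measureReal_mono ?_) hmain
  rintro S ⟨hS, v, hv, hlt⟩
  have hm : 0 < (m : ℝ) := by
    rcases Nat.eq_zero_or_pos m with rfl | h
    · simp at hlt
    · exact Nat.cast_pos.2 h
  refine ⟨(2 : ℝ) • (v - w), ?_, hlt.trans_eq ?_⟩
  · rw [norm_smul, Real.norm_of_nonneg zero_le_two]
    gcongr
  · have hvw : w + (1 / 2 : ℝ) • (2 : ℝ) • (v - w) = v := by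
      rw [smul_smul]; norm_num
    have e1 : ∫ p, f ((2 : ℝ) • (v - w)) p ∂D = excessErr D fun x => u (inner ℝ v x) := by
      rw [excessErr_eq hu.continuous hu1 hD hr (by fun_prop) (fun x => hu1 _), hf,
        integral_indicator_domain hD, hvw]
    have e2 : ∀ k, f ((2 : ℝ) • (v - w)) (S k) =
        (u (inner ℝ v (S k).1) - u (inner ℝ w (S k).1)) ^ 2 := fun k => by
      simp only [hf, Set.indicator_of_mem (hS k), hvw]
    rw [Finset.sum_sub_distrib, e1, empExcessErr, mul_sub, ← mul_assoc,
      mul_one_div_cancel hm.ne', one_mul]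
    simp [e2]

end

/-! ### Choice of constants and the union bound. -/

theorem exp_one_sub_four_log_le {m δ : ℝ} (hδ : 0 < δ) (hm : 1 ≤ m) (h2 : 2 * δ ≤ m) :
    Real.exp (1 - 4 * Real.log (m / δ)) ≤ δ / 2 := by
  have hq : 0 < δ / m := by positivity
  have hq2 : δ / m ≤ 1 / 2 := by rw [div_le_iff₀ (by linarith)]; linarith
  have hqδ : δ / m ≤ δ := div_le_self hδ.le hm
  have e : Real.exp (1 - 4 * Real.log (m / δ)) = Real.exp 1 * (δ / m) ^ 4 := by
    rw [show 1 - 4 * Real.log (m / δ) = 1 + (4 : ℕ) * Real.log (δ / m) by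
      rw [← inv_div m δ, Real.log_inv]; push_cast; ring, Real.exp_add, Real.exp_nat_mul,
      Real.exp_log hq]
  rw [e]
  calc _ ≤ 4 * ((δ / m) ^ 3 * (δ / m)) := by
        rw [← pow_succ]
        gcongr
        linarith [Real.exp_one_lt_three]
    _ ≤ 4 * ((1 / 2) ^ 3 * δ) := by gcongr
    _ = _ := by ring

end GLMTron

theorem mainTheorem2 :
    ∃ C₁ C₂ : ℝ, 0 < C₁ ∧ 0 < C₂ ∧
      ∀ (d m : ℕ) (W δ : ℝ) (u : ℝ → ℝ) (w : EuclideanSpace ℝ (Fin d))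
        (D : Measure (EuclideanSpace ℝ (Fin d) × ℝ)) [IsProbabilityMeasure D],
        0 < δ → δ < 1 → 2 * δ ≤ (m : ℝ) →
        Monotone u → LipschitzWith 1 u → (∀ z, u z ∈ Set.Icc (0 : ℝ) 1) →
        ‖w‖ ≤ W →
        (∀ᵐ p ∂D, ‖p.1‖ ≤ 1 ∧ p.2 ∈ Set.Icc (0 : ℝ) 1) →
        GLMTron.regression D =ᵐ[D] (fun p => u (inner ℝ w p.1)) →
        1 - δ ≤ (Measure.pi (fun _ : Fin m => D)).real
          {S | ∃ t : ℕ, 1 ≤ t ∧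
            (t = 1 ∨ (t : ℝ) < C₁ * (W * √((m : ℝ) / Real.log (1 / δ)))) ∧
            max (GLMTron.empExcessErr u w S (GLMTron.hyp u S t))
                (GLMTron.excessErr D (GLMTron.hyp u S t))
              ≤ C₂ * √(W ^ 2 * Real.log ((m : ℝ) / δ) / (m : ℝ))} := by
  -- The excess error is at most 12Wη + 2Wη = 14Wη, and η = 8√(L/m) gives 14 · 8 = 112. This η makes
  -- the tail exponent 1 - 4L, so each bad event costs at most δ/2.
  refine ⟨1, 112, one_pos, by norm_num, ?_⟩
  intro d m W δ u w D _ hδ hδ1 hmδ hmono hLip hu1 hw hD hr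
  have hW : 0 ≤ W := (norm_nonneg _).trans hw
  have hm0 : 0 < m := by
    rcases Nat.eq_zero_or_pos m with rfl | h
    · norm_num at hmδ; linarith
    · exact h
  have hm : (0 : ℝ) < m := Nat.cast_pos.2 hm0
  have hm1 : (1 : ℝ) ≤ m := Nat.one_le_cast.2 hm0
  set L := Real.log (m / δ) with hL
  have hL0 : 0 < L := Real.log_pos ((one_lt_div hδ).2 (by linarith))
  set η := 8 * √(L / m) with hη
  have hη0 : 0 < η := by positivity
  have hexp : Real.exp (1 - m * η ^ 2 / 16) ≤ δ / 2 := by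
    have : m * η ^ 2 / 16 = 4 * L := by
      rw [hη, mul_pow, Real.sq_sqrt (by positivity)]
      field_simp
      norm_num
    rw [this]
    exact GLMTron.exp_one_sub_four_log_le hδ hm1 hmδ
  have hWη : W * η = 8 * √(W ^ 2 * L / m) := by
    rw [mul_div_assoc, Real.sqrt_mul (sq_nonneg W), Real.sqrt_sq hW, hη]
    ring
  have hdom : ∀ᵐ S ∂(Measure.pi fun _ : Fin m => D), ∀ k, S k ∈ GLMTron.domain d :=
    ae_all_iff.2 fun k => (Measure.quasiMeasurePreserving_eval (μ := fun _ : Fin m => D) k).ae hD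
  have h1 := (GLMTron.measure_noise_gt_le hLip.continuous hu1 hD hr m hη0.le).trans hexp
  have h2 := (GLMTron.measure_excessErr_deviation_le hLip hu1 hD hr hW m hη0.le).trans hexp
  set B₁ := {S : Fin m → GLMTron.Point d |
    (∀ k, S k ∈ GLMTron.domain d) ∧ η < ‖GLMTron.noise u w S‖}
  set B₂ := {S : Fin m → GLMTron.Point d | (∀ k, S k ∈ GLMTron.domain d) ∧ ∃ v, ‖v - w‖ ≤ W ∧
    m * (2 * W * η) < m * (GLMTron.excessErr D (fun x => u (inner ℝ v x)) -
      GLMTron.empExcessErr u w S (fun x => u (inner ℝ v x)))}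
  set N := {S : Fin m → GLMTron.Point d | ¬ ∀ k, S k ∈ GLMTron.domain d}
  have hN : (Measure.pi fun _ : Fin m => D).real N = 0 := by
    rw [measureReal_def, ae_iff.1 hdom, ENNReal.toReal_zero]
  set G := {S : Fin m → GLMTron.Point d | ∃ t : ℕ, 1 ≤ t ∧
            (t = 1 ∨ (t : ℝ) < 1 * (W * √((m : ℝ) / Real.log (1 / δ)))) ∧
            max (GLMTron.empExcessErr u w S (GLMTron.hyp u S t))
                (GLMTron.excessErr D (GLMTron.hyp u S t))
              ≤ 112 * √(W ^ 2 * L / (m : ℝ))} with hG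
  have hcover : Set.univ ⊆ G ∪ (B₁ ∪ (B₂ ∪ N)) := by
    intro S _
    by_cases hS : ∀ k, S k ∈ GLMTron.domain d
    swap
    · exact Or.inr (Or.inr (Or.inr hS))
    by_cases hS1 : S ∈ B₁
    · exact Or.inr (Or.inl hS1)
    by_cases hS2 : S ∈ B₂
    · exact Or.inr (Or.inr (Or.inl hS2))
    left
    have hnoise : ‖GLMTron.noise u w S‖ ≤ η := le_of_not_gt fun h => hS1 ⟨hS, h⟩
    obtain ⟨t, ht1, ht, hball, herr⟩ := GLMTron.exists_weight_empExcessErr_le hmono hLip S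
      (fun k => (hS k).1) w hw hη0 hnoise
    have hdev : GLMTron.excessErr D (GLMTron.hyp u S t) -
        GLMTron.empExcessErr u w S (GLMTron.hyp u S t) ≤ 2 * W * η :=
      le_of_not_gt fun h => hS2 ⟨hS, _, hball, mul_lt_mul_of_pos_left h hm⟩
    have hWη0 : 0 ≤ W * η := by positivity
    refine ⟨t, ht1, ht.imp_right fun ⟨hWpos, htle⟩ => ?_, max_le (by linarith) (by linarith)⟩
    have hl0 : 0 < Real.log (1 / δ) := Real.log_pos ((one_lt_div hδ).2 hδ1)
    have hlL : Real.log (1 / δ) ≤ L := Real.log_le_log (by positivity) (by gcongr)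
    have hs : (√(L / m))⁻¹ ≤ √(m / Real.log (1 / δ)) := by
      rw [← Real.sqrt_inv, inv_div]
      exact Real.sqrt_le_sqrt (by gcongr)
    have hpos : 0 < (√(L / m))⁻¹ := by positivity
    -- The spare factor 1/4 together with W > 0 makes the bound strict; log(1/δ) ≤ L then gives the
    -- stated form.
    calc (t : ℝ) ≤ 2 * (W / η) := htle
      _ = 1 / 4 * (W * (√(L / m))⁻¹) := by rw [hη]; field_simp; norm_num
      _ < 1 * (W * (√(L / m))⁻¹) := by gcongr; norm_num
      _ ≤ _ := by gcongr
  have hsum : (1 : ℝ) ≤ (Measure.pi fun _ : Fin m => D).real G +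
      ((Measure.pi fun _ : Fin m => D).real B₁ + ((Measure.pi fun _ : Fin m => D).real B₂ +
        (Measure.pi fun _ : Fin m => D).real N)) := by
    calc (1 : ℝ) = (Measure.pi fun _ : Fin m => D).real Set.univ := by simp
      _ ≤ _ := (measureReal_mono hcover).trans <| (measureReal_union_le _ _).trans <|
          add_le_add le_rfl <| (measureReal_union_le _ _).trans <|
          add_le_add le_rfl (measureReal_union_le _ _)
  linarith
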